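/- Let $\Omega$ be a $\sigma$-compact topological space with a positive regular Borel measure $\mu$, let $K:\Omega\to\mathbb{C}$ be locally integrable, and let $(A(u))_{u\in\Omega}$ be a $\mu$-measurable commuting family of real symmetric positive definite $n\times n$-matrices such that $|\det A(u)|^{-1/2}K(u)\in L^1(\Omega,\mu)$. Then the Hausdorff operator $$(\mathcal{H}f)(x)=\int_\Omega K(u)f(A(u)x)\,d\mu(u)\qquad(\text{a.e. }x\in\mathbb{R}^n)$$ is a well-defined bounded operator on $L^2(\mathbb{R}^n)$, and there are an orthogonal matrix $C$ and vectors $a(u)=(a_1(u),\dots,a_n(u))\in\mathbb{R}^n$ with $C^{-1}A(u)C=\mathrm{diag}(a_1(u),\dots,a_n(u))$ for all $u\in\Omega$. For every such choice of $C$ and $a$, put $$\varphi(s):=\int_\Omega K(u)|a(u)|^{-1/2-is}\,d\mu(u),\qquad |a(u)|^{-1/2-is}:=\prod_{j=1}^n\exp\bigl((-\tfrac12-is_j)\log|a_j(u)|\bigr),\quad s\in\mathbb{R}^n.$$ The integral converges absolutely, $\varphi$ is bounded and continuous on $\mathbb{R}^n$, and $\mathcal{H}$ is unitarily equivalent to the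 operator of coordinate-wise multiplication by $\varphi$ in $L^2(\mathbb{R}^n;\mathbb{C}^{2^n})$. In particular, if $M'_\varphi$ denotes multiplication by $\varphi$ in $L^2(\mathbb{R}^n)$, then: (i) the spectrum of $\mathcal{H}$ equals the spectrum of $M'_\varphi$, which is the closure of the range of $\varphi$; the point spectrum and the continuous spectrum of $\mathcal{H}$ equal the point spectrum and the continuous spectrum of $M'_\varphi$, respectively; the residual spectrum of $\mathcal{H}$ is empty; (ii) $\|\mathcal{H}\|=\sup_{s\in\mathbb{R}^n}|\varphi(s)|$. -/

import Mathlib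

open MeasureTheory Matrix
open scoped ENNReal BoundedContinuousFunction

namespace HausdorffOperator

/-- The Hilbert space `L²(ℝⁿ; E)` with respect to Lebesgue measure. -/
abbrev L2 (n : ℕ) (E : Type*) [NormedAddCommGroup E] : Type _ :=
  Lp E 2 (volume : Measure (EuclideanSpace ℝ (Fin n)))

/-- `T` is the Hausdorff operator on `L²(ℝⁿ)` with kernel `K` and matrix family `A`:
`(T f)(x) = ∫ K(u) f(A(u) x) dμ(u)` for almost every `x`, the integral being absolutely
convergent for almost every `x`. -/
def IsHausdorff {Ω : Type*} [MeasurableSpace Ω] (μ : Measure Ω) {n : ℕ} (K : Ω → ℂ)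
    (A : Ω → Matrix (Fin n) (Fin n) ℝ) (T : L2 n ℂ →L[ℂ] L2 n ℂ) : Prop :=
  ∀ f : L2 n ℂ, ∀ᵐ x : EuclideanSpace ℝ (Fin n),
    Integrable (fun u => K u * f (WithLp.toLp 2 (A u *ᵥ x.ofLp))) μ ∧
    T f x = ∫ u, K u * f (WithLp.toLp 2 (A u *ᵥ x.ofLp)) ∂μ

/-- The orthogonal matrix `C` diagonalizes all `A(u)` simultaneously, with
`C⁻¹ A(u) C = diag(a₁(u), …, aₙ(u))`. -/
structure IsDiagonalization {Ω : Type*} {n : ℕ} (A : Ω → Matrix (Fin n) (Fin n) ℝ)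
    (C : Matrix (Fin n) (Fin n) ℝ) (a : Ω → Fin n → ℝ) : Prop where
  orthogonal : C ∈ Matrix.orthogonalGroup (Fin n) ℝ
  diagonal : ∀ u, C⁻¹ * A u * C = Matrix.diagonal (a u)

/-- `|v|^{-1/2 - i s} = ∏ⱼ exp((-1/2 - i sⱼ) log |vⱼ|)`. -/
noncomputable def absPow {n : ℕ} (v : Fin n → ℝ) (s : EuclideanSpace ℝ (Fin n)) : ℂ :=
  ∏ j, Complex.exp ((-(1 / 2 : ℂ) - Complex.I * (s j : ℂ)) * (Real.log |v j| : ℂ))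

/-- The scalar symbol `φ(s) = ∫ K(u) |a(u)|^{-1/2 - i s} dμ(u)`. -/
noncomputable def scalarSymbol {Ω : Type*} [MeasurableSpace Ω] (μ : Measure Ω) {n : ℕ}
    (K : Ω → ℂ) (a : Ω → Fin n → ℝ) (s : EuclideanSpace ℝ (Fin n)) : ℂ :=
  ∫ u, K u * absPow (a u) s ∂μ

section Multiplication

variable {n : ℕ} {E : Type*} [NormedAddCommGroup E] [NormedSpace ℂ E]

theorem memLp_mul (φ : EuclideanSpace ℝ (Fin n) →ᵇ ℂ) (f : L2 n E) :
    MemLp (fun s => φ s • f s) 2 (volume : Measure (EuclideanSpace ℝ (Fin n))) :=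
  (Lp.memLp f).smul (r := 2) (BoundedContinuousFunction.memLp_top φ)

/-- Multiplication by the bounded continuous scalar function `φ` on `L²(ℝⁿ; E)`
(coordinate-wise multiplication when `E = ℂᵐ`). -/
noncomputable def mulOp (E : Type*) [NormedAddCommGroup E] [NormedSpace ℂ E]
    (φ : EuclideanSpace ℝ (Fin n) →ᵇ ℂ) : L2 n E →L[ℂ] L2 n E :=
  LinearMap.mkContinuous
    { toFun := fun f => (memLp_mul φ f).toLp (fun s => φ s • f s)
      map_add' := by
        intro f g
        refine Lp.ext ?_
        filter_upwards [(memLp_mul φ (f + g)).coeFn_toLp, (memLp_mul φ f).coeFn_toLp,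
          (memLp_mul φ g).coeFn_toLp, Lp.coeFn_add f g,
          Lp.coeFn_add ((memLp_mul φ f).toLp _) ((memLp_mul φ g).toLp _)] with s h1 h2 h3 h4 h5
        rw [h1, h5, Pi.add_apply, h2, h3, h4, Pi.add_apply, smul_add]
      map_smul' := by
        intro c f
        refine Lp.ext ?_
        filter_upwards [(memLp_mul φ (c • f)).coeFn_toLp, (memLp_mul φ f).coeFn_toLp,
          Lp.coeFn_smul c f, Lp.coeFn_smul c ((memLp_mul φ f).toLp _)] with s h1 h2 h3 h4
        rw [h1, RingHom.id_apply, h4, Pi.smul_apply, h2, h3, Pi.smul_apply, smul_comm] }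
    ‖φ‖ (by
      intro f
      refine Lp.norm_le_mul_norm_of_ae_le_mul ?_
      filter_upwards [(memLp_mul φ f).coeFn_toLp] with s h
      simp only [LinearMap.coe_mk, AddHom.coe_mk]
      rw [h, norm_smul]
      exact mul_le_mul_of_nonneg_right (φ.norm_coe_le_norm s) (norm_nonneg _))

theorem coeFn_mulOp (φ : EuclideanSpace ℝ (Fin n) →ᵇ ℂ) (f : L2 n E) :
    ∀ᵐ s, mulOp E φ f s = φ s • f s :=
  (memLp_mul φ f).coeFn_toLp

end Multiplication

section Spectra

variable {X : Type*} [NormedAddCommGroup X] [NormedSpace ℂ X]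

/-- The set of eigenvalues. -/
def pointSpectrum (T : X →L[ℂ] X) : Set ℂ :=
  {z | ∃ f : X, f ≠ 0 ∧ T f = z • f}

/-- Those `z` in the spectrum for which `z - T` is injective with dense range. -/
def continuousSpectrum (T : X →L[ℂ] X) : Set ℂ :=
  {z | z ∈ spectrum ℂ T ∧
    Function.Injective (fun f : X => z • f - T f) ∧ DenseRange (fun f : X => z • f - T f)}

/-- Those `z` for which `z - T` is injective but its range is not dense (such `z` are
in the spectrum). -/
def residualSpectrum (T : X →L[ℂ] X) : Set ℂ :=
  {z | Function.Injective (fun f : X => z • f - T f) ∧ ¬ DenseRange (fun f : X => z • f - T f)}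

end Spectra

end HausdorffOperator

/-! Commuting symmetric matrices share an orthonormal eigenbasis. In it, and in the coordinates x_j
= ±exp(-2π t_j) on each of the 2^n orthants, the dilation f ↦ f ∘ A(u) becomes a translation by log
a(u)/(2π) times ∏ a_j(u)^(-1/2): positive eigenvalues keep every orthant in place, so all 2^n
components are translated alike. The Fourier transform turns translations into characters, so a
single unitary `mellinUnitary` makes every dilation the scalar multiplication by |a(u)|^(-1/2 - is)
(`mellinUnitary_dilation`). Integrating against K(u) dμ(u) gives multiplication by φ
(`integral_inner_eq_inner_mulOp`).

The integral over u is taken weakly, through ⟨g, Hf⟩ = ∫ K(u) ⟨g, f ∘ A(u)⟩ dμ(u). One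
diagonalization defines H as a conjugate of multiplication by φ. Fubini on sets of finite measure
recovers the pointwise formula (`isHausdorff_of_weak`). The weak form mentions no diagonalization,
so every other choice of C and a diagonalizes the same H.

The spectral claims are facts about multiplication operators whose criteria do not depend on the
fibre, so ℂ^(2^n) can be replaced by ℂ. -/

namespace HausdorffOperator

/-! ### Spectrum and norm of multiplication operators. -/

section Spectral

variable {n : ℕ} {E : Type*} [NormedAddCommGroup E] [NormedSpace ℂ E]

theorem mulOp_mulOp (φ ψ : EuclideanSpace ℝ (Fin n) →ᵇ ℂ) (f : L2 n E) :
    mulOp E φ (mulOp E ψ f) = mulOp E (φ * ψ) f := by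
  refine Lp.ext ?_
  filter_upwards [coeFn_mulOp φ (mulOp E ψ f), coeFn_mulOp ψ f, coeFn_mulOp (φ * ψ) f]
    with s h1 h2 h3
  rw [h1, h2, h3, smul_smul, BoundedContinuousFunction.mul_apply]

theorem mulOp_one (f : L2 n E) : mulOp E 1 f = f := by
  refine Lp.ext ?_
  filter_upwards [coeFn_mulOp 1 f] with s h1
  rw [h1, BoundedContinuousFunction.coe_one, Pi.one_apply, one_smul]

theorem mulOp_const_sub (z : ℂ) (φ : EuclideanSpace ℝ (Fin n) →ᵇ ℂ) (f : L2 n E) :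
    mulOp E (BoundedContinuousFunction.const _ z - φ) f = z • f - mulOp E φ f := by
  refine Lp.ext ?_
  filter_upwards [coeFn_mulOp φ f, coeFn_mulOp (BoundedContinuousFunction.const _ z - φ) f,
    Lp.coeFn_sub (z • f) (mulOp E φ f), Lp.coeFn_smul z f] with s h1 h2 h3 h4
  rw [h3, Pi.sub_apply, h4, h1, h2, Pi.smul_apply]
  simp [sub_smul]

/-- Serves with ε = 0 for kernels, with small ε for approximate eigenvectors, and with S the whole
space for the norm. -/
theorem mulOp_norm_le_on {φ : EuclideanSpace ℝ (Fin n) →ᵇ ℂ} {ε : ℝ} {f : L2 n E}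
    {S : Set (EuclideanSpace ℝ (Fin n))} (hf : ∀ᵐ s, s ∉ S → f s = 0)
    (hS : ∀ s ∈ S, ‖φ s‖ ≤ ε) : ‖mulOp E φ f‖ ≤ ε * ‖f‖ := by
  refine Lp.norm_le_mul_norm_of_ae_le_mul ?_
  filter_upwards [hf, coeFn_mulOp φ f] with s h1 h2
  rw [h2, norm_smul]
  by_cases hs : s ∈ S
  · exact mul_le_mul_of_nonneg_right (hS s hs) (norm_nonneg _)
  · simp [h1 hs]

omit [NormedSpace ℂ E] in
theorem exists_ne_zero_supported [Nontrivial E] {S : Set (EuclideanSpace ℝ (Fin n))}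
    (hS : MeasurableSet S) (hS0 : volume S ≠ 0) :
    ∃ f : L2 n E, f ≠ 0 ∧ ∀ᵐ s, s ∉ S → f s = 0 := by
  obtain ⟨t, htm, htS, ht0, htf⟩ :=
    Measure.exists_subset_measure_lt_top hS (pos_iff_ne_zero.mpr hS0)
  obtain ⟨c, hc⟩ := exists_ne (0 : E)
  refine ⟨indicatorConstLp 2 htm htf.ne c, ?_, ?_⟩
  · rw [← norm_pos_iff, norm_indicatorConstLp (by simp) (by simp)]
    have : 0 < volume.real t := ENNReal.toReal_pos ht0.ne' htf.ne
    have : 0 < ‖c‖ := norm_pos_iff.mpr hc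
    positivity
  · filter_upwards [indicatorConstLp_coeFn (p := 2) (hs := htm) (hμs := htf.ne) (c := c)] with s h1 hs
    rw [h1, Set.indicator_of_notMem fun h => hs (htS h)]

theorem injective_mulOp_iff [Nontrivial E] (φ : EuclideanSpace ℝ (Fin n) →ᵇ ℂ) :
    Function.Injective (mulOp E φ) ↔ volume {s | φ s = 0} = 0 := by
  constructor
  · intro h
    by_contra h0
    obtain ⟨f, hf0, hf⟩ := exists_ne_zero_supported (E := E)
      (isClosed_eq φ.continuous continuous_const).measurableSet h0
    refine hf0 (h ?_)
    rw [map_zero]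
    have := mulOp_norm_le_on (φ := φ) (ε := 0) hf (by intro s hs; simpa using hs)
    simpa using this
  · intro h
    rw [injective_iff_map_eq_zero]
    intro f hf
    rw [Lp.eq_zero_iff_ae_eq_zero] at hf ⊢
    have h' : ∀ᵐ s, φ s ≠ 0 := by simpa [ae_iff] using h
    filter_upwards [hf, coeFn_mulOp φ f, h'] with s h1 h2 h3
    rw [h1] at h2
    simpa [h3] using h2.symm

/-- The criterion does not involve E, which lets eigenvalues pass between the fibres ℂ^(2^n) and ℂ.
-/
theorem mem_pointSpectrum_mulOp_iff [Nontrivial E] (φ : EuclideanSpace ℝ (Fin n) →ᵇ ℂ) (z : ℂ) :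
    z ∈ pointSpectrum (mulOp E φ) ↔ volume {s | φ s = z} ≠ 0 := by
  have h := injective_mulOp_iff (E := E) (BoundedContinuousFunction.const _ z - φ)
  have hset : {s | (BoundedContinuousFunction.const (EuclideanSpace ℝ (Fin n)) z - φ) s = 0} = {s | φ s = z} := by
    ext s
    change z - φ s = 0 ↔ φ s = z
    rw [sub_eq_zero, eq_comm]
  rw [hset, injective_iff_map_eq_zero] at h
  rw [ne_eq, ← h, pointSpectrum]
  push Not
  refine exists_congr fun f => ?_
  rw [mulOp_const_sub, sub_eq_zero, eq_comm (a := z • f), and_comm]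

/-- Off the closure of the range, 1/(z - φ) is bounded and inverts. On it, functions supported where
|z - φ| is small are approximate eigenvectors, which a bounded inverse excludes. -/
theorem spectrum_mulOp [CompleteSpace E] [Nontrivial E] (φ : EuclideanSpace ℝ (Fin n) →ᵇ ℂ) :
    spectrum ℂ (mulOp E φ) = closure (Set.range φ) := by
  ext z
  rw [spectrum.mem_iff]
  set ψ := BoundedContinuousFunction.const _ z - φ with hψ
  have hz : algebraMap ℂ (L2 n E →L[ℂ] L2 n E) z - mulOp E φ = mulOp E ψ := by
    ext1 f
    rw [hψ, mulOp_const_sub]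
    simp [Algebra.algebraMap_eq_smul_one]
  rw [hz]
  constructor
  · intro h
    by_contra hcl
    rw [Metric.mem_closure_iff] at hcl
    push Not at hcl
    obtain ⟨ε, hε, hb⟩ := hcl
    have hb' : ∀ s, ε ≤ ‖ψ s‖ := fun s => by
      have := hb (φ s) ⟨s, rfl⟩
      rwa [dist_eq_norm] at this
    have hne : ∀ s, ψ s ≠ 0 := fun s h0 => by
      have := hb' s
      rw [h0, norm_zero] at this
      linarith
    let χ : EuclideanSpace ℝ (Fin n) →ᵇ ℂ := BoundedContinuousFunction.ofNormedAddCommGroup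
      (fun s => (ψ s)⁻¹) (ψ.continuous.inv₀ hne) ε⁻¹ (fun s => by
        rw [norm_inv]
        exact inv_anti₀ hε (hb' s))
    have h1 : ψ * χ = 1 := by
      ext s
      exact mul_inv_cancel₀ (hne s)
    apply h
    refine ⟨⟨mulOp E ψ, mulOp E χ, ?_, ?_⟩, rfl⟩
    · ext1 f
      simp [mulOp_mulOp, h1, mulOp_one]
    · ext1 f
      simp [mulOp_mulOp, mul_comm χ, h1, mulOp_one]
  · rintro hcl ⟨u, hu⟩
    set c := ‖((u⁻¹ : (L2 n E →L[ℂ] L2 n E)ˣ) : L2 n E →L[ℂ] L2 n E)‖ with hc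
    have hc0 : 0 ≤ c := norm_nonneg _
    rw [Metric.mem_closure_iff] at hcl
    -- With this radius the inverse would yield ‖f‖ ≤ c/(c+1) ‖f‖ for a nonzero f; the +1 also
    -- covers c = 0.
    obtain ⟨_, ⟨s₀, rfl⟩, hs₀⟩ := hcl (1 / (c + 1)) (by positivity)
    have hopen : IsOpen {s | ‖ψ s‖ < 1 / (c + 1)} := isOpen_lt ψ.continuous.norm continuous_const
    obtain ⟨f, hf0, hf⟩ := exists_ne_zero_supported (E := E) hopen.measurableSet
      (hopen.measure_pos volume ⟨s₀, by simpa [hψ, dist_eq_norm] using hs₀⟩).ne'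
    have h1 := mulOp_norm_le_on (φ := ψ) hf (fun s hs => le_of_lt hs)
    have h2 : ((u⁻¹ : (L2 n E →L[ℂ] L2 n E)ˣ) : L2 n E →L[ℂ] L2 n E) (mulOp E ψ f) = f := by
      rw [← hu, ← mul_apply_eq_comp, Units.inv_mul]
      rfl
    have h3 : ‖f‖ ≤ c * ‖mulOp E ψ f‖ := by
      conv_lhs => rw [← h2]
      exact ContinuousLinearMap.le_opNorm _ _
    have hfpos : 0 < ‖f‖ := norm_pos_iff.mpr hf0
    have h4 : ‖f‖ ≤ c * (1 / (c + 1)) * ‖f‖ := by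
      calc ‖f‖ ≤ c * ‖mulOp E ψ f‖ := h3
        _ ≤ c * (1 / (c + 1) * ‖f‖) := by gcongr
        _ = _ := by ring
    have h5 : c * (1 / (c + 1)) < 1 := by
      rw [mul_one_div, div_lt_one (by linarith)]
      linarith
    nlinarith

omit [NormedSpace ℂ E] in
theorem nontrivial_L2 [Nontrivial E] : Nontrivial (L2 n E) := by
  obtain ⟨f, hf, -⟩ := exists_ne_zero_supported (n := n) (E := E) MeasurableSet.univ (by
    exact (isOpen_univ.measure_pos volume Set.univ_nonempty).ne')
  exact ⟨f, 0, hf⟩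

/-- Each φ(s) is a spectral value, hence bounded by the operator norm; this gives the lower estimate
of the norm. -/
theorem isLUB_norm_mulOp [CompleteSpace E] [Nontrivial E] (φ : EuclideanSpace ℝ (Fin n) →ᵇ ℂ) :
    IsLUB (Set.range fun s => ‖φ s‖) ‖mulOp E φ‖ := by
  have := nontrivial_L2 (n := n) (E := E)
  constructor
  · rintro _ ⟨s, rfl⟩
    refine spectrum.norm_le_norm_of_mem (𝕜 := ℂ) ?_
    rw [spectrum_mulOp]
    exact subset_closure ⟨s, rfl⟩
  · intro b hb
    have hb' : ∀ s, ‖φ s‖ ≤ b := fun s => hb ⟨s, rfl⟩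
    refine ContinuousLinearMap.opNorm_le_bound _ ((norm_nonneg _).trans (hb' 0)) fun f => ?_
    exact mulOp_norm_le_on (S := Set.univ) (by simp) fun s _ => hb' s

end Spectral

/-! ### Absence of residual spectrum. -/

section SpectralInner

variable {n : ℕ} {E : Type*} [NormedAddCommGroup E] [InnerProductSpace ℂ E] [CompleteSpace E]

omit [CompleteSpace E] in
theorem inner_mulOp_left (φ : EuclideanSpace ℝ (Fin n) →ᵇ ℂ) (f g : L2 n E) :
    inner ℂ (mulOp E φ f) g = inner ℂ f (mulOp E (star φ) g) := by
  rw [L2.inner_def, L2.inner_def]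
  refine integral_congr_ae ?_
  filter_upwards [coeFn_mulOp φ f, coeFn_mulOp (star φ) g] with s h1 h2
  rw [h1, h2, inner_smul_left, inner_smul_right]
  rfl

/-- The orthogonal complement of the range is the kernel of the adjoint, multiplication by `star φ`,
which has the same zero set as φ. -/
theorem denseRange_mulOp_of_injective [Nontrivial E] {φ : EuclideanSpace ℝ (Fin n) →ᵇ ℂ}
    (h : Function.Injective (mulOp E φ)) : DenseRange (mulOp E φ) := by
  have hstar : Function.Injective (mulOp E (star φ)) := by
    rw [injective_mulOp_iff] at h ⊢
    simpa using h
  have hd : (LinearMap.range (mulOp E φ).toLinearMap).topologicalClosure = ⊤ := by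
    rw [Submodule.topologicalClosure_eq_top_iff, Submodule.eq_bot_iff]
    intro g hg
    refine hstar ?_
    rw [map_zero, ← inner_self_eq_zero (𝕜 := ℂ), ← inner_mulOp_left]
    exact (Submodule.mem_orthogonal _ _).1 hg _ ⟨_, rfl⟩
  rw [DenseRange, dense_iff_closure_eq]
  exact congrArg (fun p : Submodule ℂ (L2 n E) => (p : Set (L2 n E))) hd

theorem residualSpectrum_mulOp [Nontrivial E] (φ : EuclideanSpace ℝ (Fin n) →ᵇ ℂ) :
    residualSpectrum (mulOp E φ) = ∅ := by
  refine Set.eq_empty_of_forall_notMem fun z hz => ?_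
  simp only [residualSpectrum, Set.mem_ofPred_eq, ← mulOp_const_sub] at hz
  exact hz.2 (denseRange_mulOp_of_injective hz.1)

end SpectralInner

/-! ### Invariance of spectra and norm under unitary equivalence. -/

section Equivalence

variable {X Y : Type*} [NormedAddCommGroup X] [NormedSpace ℂ X]
  [NormedAddCommGroup Y] [NormedSpace ℂ Y]

theorem injective_smul_sub_iff (T : X →L[ℂ] X) (z : ℂ) :
    Function.Injective (fun f : X => z • f - T f) ↔ z ∉ pointSpectrum T := by
  have := injective_iff_map_eq_zero (z • ContinuousLinearMap.id ℂ X - T)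
  have h2 : (fun f : X => z • f - T f) = ⇑(z • ContinuousLinearMap.id ℂ X - T) := by
    ext f; simp
  rw [h2, this, pointSpectrum]
  simp only [Set.mem_ofPred_eq]
  push Not
  refine forall_congr' fun f => ?_
  simp only [_root_.sub_apply, _root_.smul_apply, ContinuousLinearMap.id_apply, sub_eq_zero]
  tauto

theorem continuousSpectrum_eq_of_residualSpectrum_eq_empty {T : X →L[ℂ] X}
    (hT : residualSpectrum T = ∅) : continuousSpectrum T = spectrum ℂ T \ pointSpectrum T := by
  ext z
  have hz : z ∉ residualSpectrum T := by simp [hT]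
  simp only [residualSpectrum, Set.mem_ofPred_eq, not_and, not_not] at hz
  simp only [continuousSpectrum, Set.mem_ofPred_eq, Set.mem_sdiff, ← injective_smul_sub_iff]
  tauto

variable {U : X ≃ₗᵢ[ℂ] Y} {T : X →L[ℂ] X} {S : Y →L[ℂ] Y}

theorem pointSpectrum_eq_of_intertwine (h : ∀ f, U (T f) = S (U f)) :
    pointSpectrum T = pointSpectrum S := by
  ext z
  constructor
  · rintro ⟨f, hf, hz⟩
    exact ⟨U f, by simpa using hf, by rw [← h, hz, map_smul]⟩
  · rintro ⟨g, hg, hz⟩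
    refine ⟨U.symm g, by simpa using hg, U.injective ?_⟩
    rw [h, U.apply_symm_apply, hz, map_smul, U.apply_symm_apply]

theorem spectrum_eq_of_intertwine (h : ∀ f, U (T f) = S (U f)) :
    spectrum ℂ T = spectrum ℂ S := by
  have : S = U.toContinuousLinearEquiv.conjContinuousAlgEquiv T := by
    ext1 g
    simp [ContinuousLinearEquiv.conjContinuousAlgEquiv_apply_apply, h]
  rw [this]
  exact (AlgEquiv.spectrum_eq (U.toContinuousLinearEquiv.conjContinuousAlgEquiv) T).symm

theorem residualSpectrum_eq_of_intertwine (h : ∀ f, U (T f) = S (U f)) :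
    residualSpectrum T = residualSpectrum S := by
  ext z
  simp only [residualSpectrum, Set.mem_ofPred_eq, injective_smul_sub_iff,
    pointSpectrum_eq_of_intertwine h]
  have h2 : (fun g : Y => z • g - S g) = U ∘ (fun f : X => z • f - T f) ∘ U.symm := by
    ext g
    simp [h]
  have h3 : (fun f : X => z • f - T f) = U.symm ∘ (fun g : Y => z • g - S g) ∘ U := by
    ext f
    simp [← h]
  refine and_congr_right fun _ => not_congr ⟨fun hd => ?_, fun hd => ?_⟩
  · rw [h2]
    exact U.surjective.denseRange.comp (hd.comp U.symm.surjective.denseRange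
      (by fun_prop)) U.continuous
  · rw [h3]
    exact U.symm.surjective.denseRange.comp (hd.comp U.surjective.denseRange
      (by fun_prop)) U.symm.continuous

theorem norm_eq_of_intertwine (h : ∀ f, U (T f) = S (U f)) : ‖T‖ = ‖S‖ := by
  refine le_antisymm ?_ ?_
  · refine ContinuousLinearMap.opNorm_le_bound _ (norm_nonneg _) fun f => ?_
    rw [← U.norm_map, h, ← U.norm_map f]
    exact S.le_opNorm _
  · refine ContinuousLinearMap.opNorm_le_bound _ (norm_nonneg _) fun g => ?_
    obtain ⟨f, rfl⟩ := U.surjective g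
    rw [← h, U.norm_map, U.norm_map]
    exact T.le_opNorm _

end Equivalence

/-! ### Unitary maps of L² spaces from changes of variables. -/

section Chart

variable {X Y ι : Type*} [MeasurableSpace X] [MeasurableSpace Y] [Fintype ι]

/-- A measurable parametrization of `X`, up to null sets, by disjoint copies `e i` of `Y` whose
Jacobian is `w ^ 2`. -/
structure Chart (μ : Measure X) (ν : Measure Y) (e : ι → Y → X) (w : Y → ℝ) : Prop where
  measurable_map : ∀ i, Measurable (e i)
  measurable_weight : Measurable w
  weight_pos : ∀ t, 0 < w t
  lintegral_eq : ∀ h : X → ℝ≥0∞, Measurable h →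
    ∫⁻ x, h x ∂μ = ∑ i, ∫⁻ t, ENNReal.ofReal (w t ^ 2) * h (e i t) ∂ν
  exists_inverse : ∃ (l : X → Y) (idx : X → ι), Measurable l ∧
    (∀ i, MeasurableSet (idx ⁻¹' {i})) ∧ (∀ i t, l (e i t) = t) ∧ ∀ i t, idx (e i t) = i

variable {μ : Measure X} {ν : Measure Y} {e : ι → Y → X} {w : Y → ℝ}

/-- The change of variables applied to the indicator of a null set suffices, because the weight
never vanishes. This makes `pullback` well defined on almost-everywhere classes. -/
theorem Chart.quasiMeasurePreserving (hc : Chart μ ν e w) (i : ι) :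
    Measure.QuasiMeasurePreserving (e i) ν μ := by
  refine ⟨hc.measurable_map i, Measure.AbsolutelyContinuous.mk fun s hs hs0 => ?_⟩
  have h := hc.lintegral_eq (s.indicator 1) (measurable_one.indicator hs)
  rw [lintegral_indicator_one hs, hs0, eq_comm, Finset.sum_eq_zero_iff] at h
  have h1 := h i (Finset.mem_univ i)
  rw [lintegral_eq_zero_iff (by
    have := hc.measurable_weight
    have := (measurable_one (α := ℝ≥0∞)).indicator hs |>.comp (hc.measurable_map i)
    exact Measurable.mul (by fun_prop) this)] at h1
  rw [Measure.map_apply (hc.measurable_map i) hs, measure_eq_zero_iff_ae_notMem]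
  filter_upwards [h1] with t ht hts
  have h2 : 0 < w t ^ 2 := pow_pos (hc.weight_pos t) 2
  have hts' : e i t ∈ s := hts
  simp [hts', not_le.mpr h2] at ht

/-- The pull-back of a function on `X` along all the pieces of a chart. -/
noncomputable def pullback (e : ι → Y → X) (w : Y → ℝ) (f : X → ℂ) (t : Y) : EuclideanSpace ℂ ι :=
  WithLp.toLp 2 fun i => (w t : ℂ) * f (e i t)

theorem measurable_pullback (hc : Chart μ ν e w) {f : X → ℂ} (hf : Measurable f) :
    Measurable (pullback e w f) := by
  have := hc.measurable_weight
  have := hc.measurable_map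
  unfold pullback
  refine (WithLp.measurable_toLp 2 _).comp (measurable_pi_lambda _ fun i => ?_)
  fun_prop

theorem eLpNorm_pullback (hc : Chart μ ν e w) {f : X → ℂ} (hf : Measurable f) :
    eLpNorm (pullback e w f) 2 ν = eLpNorm f 2 μ := by
  have hw := hc.measurable_weight
  have he := hc.measurable_map
  rw [eLpNorm_eq_lintegral_rpow_enorm_toReal (by simp) (by simp),
    eLpNorm_eq_lintegral_rpow_enorm_toReal (by simp) (by simp)]
  congr 1
  simp only [ENNReal.toReal_ofNat, ENNReal.rpow_ofNat]
  rw [hc.lintegral_eq _ (by fun_prop), ← lintegral_finsetSum _ (by fun_prop)]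
  refine lintegral_congr fun t => ?_
  rw [← ofReal_norm, ← ENNReal.ofReal_pow (norm_nonneg _), EuclideanSpace.norm_sq_eq,
    ENNReal.ofReal_sum_of_nonneg (fun _ _ => by positivity)]
  refine Finset.sum_congr rfl fun i _ => ?_
  rw [← ofReal_norm, ← ENNReal.ofReal_pow (norm_nonneg _),
    ← ENNReal.ofReal_mul (by positivity), pullback, norm_mul, mul_pow]
  simp

theorem memLp_pullback (hc : Chart μ ν e w) (f : Lp ℂ 2 μ) : MemLp (pullback e w f) 2 ν := by
  have hf : Measurable f := (Lp.stronglyMeasurable f).measurable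
  refine ⟨(measurable_pullback hc hf).aestronglyMeasurable, ?_⟩
  rw [eLpNorm_pullback hc hf]
  exact Lp.eLpNorm_lt_top f

/-- The isometry of `L²` spaces induced by a chart. -/
noncomputable def chartIsometry (hc : Chart μ ν e w) :
    Lp ℂ 2 μ →ₗᵢ[ℂ] Lp (EuclideanSpace ℂ ι) 2 ν where
  toFun f := (memLp_pullback hc f).toLp _
  map_add' f g := by
    refine Lp.ext ?_
    have h : ∀ i, ∀ᵐ t ∂ν, (f + g : Lp ℂ 2 μ) (e i t) = f (e i t) + g (e i t) := fun i =>
      (hc.quasiMeasurePreserving i).ae (Lp.coeFn_add f g)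
    filter_upwards [(memLp_pullback hc (f + g)).coeFn_toLp, (memLp_pullback hc f).coeFn_toLp,
      (memLp_pullback hc g).coeFn_toLp, Lp.coeFn_add ((memLp_pullback hc f).toLp _)
      ((memLp_pullback hc g).toLp _), ae_all_iff.2 h] with t h1 h2 h3 h4 h5
    rw [h1, h4, Pi.add_apply, h2, h3]
    ext i
    simp only [pullback, PiLp.add_apply]
    rw [h5, mul_add]
  map_smul' c f := by
    refine Lp.ext ?_
    have h : ∀ i, ∀ᵐ t ∂ν, (c • f : Lp ℂ 2 μ) (e i t) = c • f (e i t) := fun i =>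
      (hc.quasiMeasurePreserving i).ae (Lp.coeFn_smul c f)
    filter_upwards [(memLp_pullback hc (c • f)).coeFn_toLp, (memLp_pullback hc f).coeFn_toLp,
      Lp.coeFn_smul c ((memLp_pullback hc f).toLp _), ae_all_iff.2 h] with t h1 h2 h3 h4
    rw [h1, RingHom.id_apply, h3, Pi.smul_apply, h2]
    ext i
    simp only [pullback, PiLp.smul_apply]
    rw [h4, smul_eq_mul, smul_eq_mul, mul_left_comm]
  norm_map' f := by
    simp only [LinearMap.coe_mk, AddHom.coe_mk]
    rw [Lp.norm_toLp, eLpNorm_pullback hc (Lp.stronglyMeasurable f).measurable, Lp.norm_def]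

theorem coeFn_chartIsometry (hc : Chart μ ν e w) (f : Lp ℂ 2 μ) :
    chartIsometry hc f =ᵐ[ν] pullback e w f :=
  (memLp_pullback hc f).coeFn_toLp

theorem pullback_congr_ae (hc : Chart μ ν e w) {f g : X → ℂ} (h : f =ᵐ[μ] g) :
    pullback e w f =ᵐ[ν] pullback e w g := by
  have h' : ∀ i, ∀ᵐ t ∂ν, f (e i t) = g (e i t) := fun i => (hc.quasiMeasurePreserving i).ae h
  filter_upwards [ae_all_iff.2 h'] with t ht
  simp [pullback, ht]

theorem chartIsometry_surjective (hc : Chart μ ν e w) :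
    Function.Surjective (chartIsometry hc) := by
  intro g
  obtain ⟨l, idx, hl, hidx, hle, hidxe⟩ := hc.exists_inverse
  have hg : Measurable g := (Lp.stronglyMeasurable g).measurable
  have hw := hc.measurable_weight
  -- The components of g are glued along the pieces. Values outside the images of the `e i` are
  -- irrelevant, since `lintegral_eq` gives them no mass.
  let f : X → ℂ := fun x => ∑ i, (idx ⁻¹' {i}).indicator (fun x => (w (l x) : ℂ)⁻¹ * g (l x) i) x
  have hf : Measurable f := by
    refine Finset.measurable_fun_sum _ fun i _ => Measurable.indicator ?_ (hidx i)
    have : Measurable fun t => g t i := by fun_prop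
    exact Measurable.mul (by fun_prop) (this.comp hl)
  have hfe : pullback e w f = g := by
    ext t i
    have hw0 : (w t : ℂ) ≠ 0 := by exact_mod_cast (hc.weight_pos t).ne'
    have : f (e i t) = (w t : ℂ)⁻¹ * g t i := by
      simp only [f]
      rw [Finset.sum_eq_single i]
      · rw [Set.indicator_of_mem (by simp [hidxe]), hle]
      · intro j _ hj
        exact Set.indicator_of_notMem (by simpa [hidxe] using hj.symm) _
      · simp
    simp [pullback, this, hw0]
  have hmem : MemLp f 2 μ := ⟨hf.aestronglyMeasurable, by
    rw [← eLpNorm_pullback hc hf, hfe]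
    exact Lp.eLpNorm_lt_top g⟩
  refine ⟨hmem.toLp f, Lp.ext ?_⟩
  exact ((coeFn_chartIsometry hc _).trans (pullback_congr_ae hc hmem.coeFn_toLp)).trans
    (by rw [hfe])

/-- The unitary map of `L²` spaces induced by a chart. -/
noncomputable def chartUnitary (hc : Chart μ ν e w) :
    Lp ℂ 2 μ ≃ₗᵢ[ℂ] Lp (EuclideanSpace ℂ ι) 2 ν :=
  LinearIsometryEquiv.ofSurjective (chartIsometry hc) (chartIsometry_surjective hc)

theorem coeFn_chartUnitary (hc : Chart μ ν e w) (f : Lp ℂ 2 μ) :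
    chartUnitary hc f =ᵐ[ν] pullback e w f :=
  coeFn_chartIsometry hc f

end Chart

/-! ### Exponential coordinates on the 2^n orthants. -/

section OrthantChart

variable {n : ℕ}

/-- The signs of the coordinates in the `k`-th orthant of `ℝⁿ`. -/
noncomputable def orthantSign (k : Fin (2 ^ n)) (j : Fin n) : ℝ :=
  if finFunctionFinEquiv.symm k j = 0 then 1 else -1

theorem orthantSign_ne_zero (k : Fin (2 ^ n)) (j : Fin n) : orthantSign k j ≠ 0 := by
  unfold orthantSign
  split_ifs <;> norm_num

theorem abs_orthantSign (k : Fin (2 ^ n)) (j : Fin n) : |orthantSign k j| = 1 := by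
  unfold orthantSign
  split_ifs <;> norm_num

/-- Exponential coordinates on the `k`-th orthant. -/
noncomputable def orthantExp (k : Fin (2 ^ n)) (t : Fin n → ℝ) (j : Fin n) : ℝ :=
  orthantSign k j * Real.exp (-(2 * Real.pi) * t j)

/-- The inverse of the exponential coordinates. -/
noncomputable def orthantLog (x : Fin n → ℝ) (j : Fin n) : ℝ :=
  -Real.log |x j| / (2 * Real.pi)

/-- The orthant containing a point. -/
noncomputable def orthantIndex (x : Fin n → ℝ) : Fin (2 ^ n) :=
  finFunctionFinEquiv fun j => if 0 < x j then 0 else 1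

theorem orthantExp_ne_zero (k : Fin (2 ^ n)) (t : Fin n → ℝ) (j : Fin n) :
    orthantExp k t j ≠ 0 :=
  mul_ne_zero (orthantSign_ne_zero k j) (Real.exp_pos _).ne'

theorem orthantLog_orthantExp (k : Fin (2 ^ n)) (t : Fin n → ℝ) :
    orthantLog (orthantExp k t) = t := by
  ext j
  rw [orthantLog, orthantExp, abs_mul, abs_orthantSign, one_mul, Real.abs_exp, Real.log_exp]
  field_simp

theorem orthantIndex_orthantExp (k : Fin (2 ^ n)) (t : Fin n → ℝ) :
    orthantIndex (orthantExp k t) = k := by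
  rw [orthantIndex, ← Equiv.eq_symm_apply]
  ext1 j
  unfold orthantExp orthantSign
  by_cases h : finFunctionFinEquiv.symm k j = 0
  · simp [h, Real.exp_pos]
  · have h1 : finFunctionFinEquiv.symm k j = 1 := by omega
    simp [h1, Real.exp_nonneg]

theorem orthantExp_orthantLog {x : Fin n → ℝ} (hx : ∀ j, x j ≠ 0) :
    orthantExp (orthantIndex x) (orthantLog x) = x := by
  ext j
  have h1 : -(2 * Real.pi) * (-Real.log |x j| / (2 * Real.pi)) = Real.log |x j| := by
    field_simp
  rw [orthantExp, orthantLog, h1, Real.exp_log (abs_pos.2 (hx j)), orthantSign, orthantIndex,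
    Equiv.symm_apply_apply]
  rcases lt_or_gt_of_ne (hx j) with h | h
  · simp [not_lt.2 h.le, abs_of_neg h]
  · simp [h, abs_of_pos h]

theorem image_orthantExp (k : Fin (2 ^ n)) :
    orthantExp k '' Set.univ = {x | ∀ j, x j ≠ 0} ∩ orthantIndex ⁻¹' {k} := by
  ext x
  simp only [Set.image_univ, Set.mem_range, Set.mem_inter_iff, Set.mem_ofPred_eq,
    Set.mem_preimage, Set.mem_singleton_iff]
  constructor
  · rintro ⟨t, rfl⟩
    exact ⟨orthantExp_ne_zero k t, orthantIndex_orthantExp k t⟩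
  · rintro ⟨hx, rfl⟩
    exact ⟨orthantLog x, orthantExp_orthantLog hx⟩

theorem measurable_orthantExp (k : Fin (2 ^ n)) : Measurable (orthantExp k) := by
  unfold orthantExp
  fun_prop

theorem measurable_orthantLog : Measurable (orthantLog (n := n)) := by
  unfold orthantLog
  refine measurable_pi_lambda _ fun j => ?_
  have : Measurable fun x : Fin n → ℝ => |x j| := (measurable_pi_apply j).abs
  fun_prop

theorem measurableSet_orthantIndex (k : Fin (2 ^ n)) :
    MeasurableSet (orthantIndex (n := n) ⁻¹' {k}) := by
  have h : Measurable fun (x : Fin n → ℝ) (j : Fin n) => if 0 < x j then (0 : Fin 2) else 1 :=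
    measurable_pi_lambda _ fun j => Measurable.ite
      (measurableSet_lt measurable_const (measurable_pi_apply j)) measurable_const measurable_const
  have h2 : orthantIndex (n := n) ⁻¹' {k} =
      (fun (x : Fin n → ℝ) (j : Fin n) => if 0 < x j then (0 : Fin 2) else 1) ⁻¹'
        {finFunctionFinEquiv.symm k} := by
    ext x
    simp only [Set.mem_preimage, Set.mem_singleton_iff, orthantIndex]
    rw [← Equiv.eq_symm_apply]
  rw [h2]
  exact h (measurableSet_singleton _)

/-- The square root of the Jacobian of the exponential coordinates. -/
noncomputable def orthantWeight (t : Fin n → ℝ) : ℝ :=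
  ∏ j, (Real.sqrt (2 * Real.pi) * Real.exp (-Real.pi * t j))

theorem orthantWeight_pos (t : Fin n → ℝ) : 0 < orthantWeight t :=
  Finset.prod_pos fun j _ => by positivity

theorem hasFDerivAt_orthantExp (k : Fin (2 ^ n)) (t : Fin n → ℝ) :
    HasFDerivAt (orthantExp k) (LinearMap.toContinuousLinearMap (Matrix.toLin' (Matrix.diagonal
      fun j => orthantSign k j * (Real.exp (-(2 * Real.pi) * t j) * -(2 * Real.pi))))) t := by
  rw [hasFDerivAt_pi']
  intro j
  have h1 : HasFDerivAt (fun x : Fin n → ℝ => -(2 * Real.pi) * x j)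
      (-(2 * Real.pi) • ContinuousLinearMap.proj (R := ℝ) (φ := fun _ : Fin n => ℝ) j) t :=
    (ContinuousLinearMap.proj (R := ℝ) (φ := fun _ : Fin n => ℝ) j).hasFDerivAt.const_mul _
  have h2 := (h1.exp).const_mul (orthantSign k j)
  refine h2.congr_fderiv ?_
  ext v
  simp [Matrix.mulVec_diagonal]
  ring

theorem abs_det_orthantExp (k : Fin (2 ^ n)) (t : Fin n → ℝ) :
    |(LinearMap.toContinuousLinearMap (Matrix.toLin' (Matrix.diagonal
      fun j => orthantSign k j * (Real.exp (-(2 * Real.pi) * t j) * -(2 * Real.pi)))) :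
      (Fin n → ℝ) →L[ℝ] Fin n → ℝ).det| = orthantWeight t ^ 2 := by
  rw [ContinuousLinearMap.det, LinearMap.coe_toContinuousLinearMap, LinearMap.det_toLin',
    Matrix.det_diagonal, Finset.abs_prod, orthantWeight, ← Finset.prod_pow]
  refine Finset.prod_congr rfl fun j _ => ?_
  rw [abs_mul, abs_orthantSign, abs_mul, Real.abs_exp, abs_neg, abs_of_pos (by positivity),
    mul_pow, Real.sq_sqrt (by positivity), ← Real.exp_nat_mul]
  push_cast
  ring_nf

/-- Off the null coordinate hyperplanes the orthants partition space, each being the injective image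
of one exponential map with Jacobian `orthantWeight t ^ 2`. -/
theorem lintegral_eq_sum_orthantExp (h : (Fin n → ℝ) → ℝ≥0∞) :
    ∫⁻ x, h x = ∑ k, ∫⁻ t, ENNReal.ofReal (orthantWeight t ^ 2) * h (orthantExp k t) := by
  have hae : ∀ᵐ x : Fin n → ℝ, x ∈ ⋃ k, orthantExp k '' Set.univ := by
    have h0 : ∀ j : Fin n, ∀ᵐ x : Fin n → ℝ, x j ≠ 0 := fun j => by
      have := Measure.pi_hyperplane (fun _ : Fin n => (volume : Measure ℝ)) j 0
      rw [ae_iff]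
      simpa [volume_pi] using this
    filter_upwards [ae_all_iff.2 h0] with x hx
    rw [Set.mem_iUnion]
    refine ⟨orthantIndex x, ?_⟩
    rw [image_orthantExp]
    exact ⟨hx, rfl⟩
  have hG : MeasurableSet {x : Fin n → ℝ | ∀ j, x j ≠ 0} := by
    rw [Set.ofPred_forall]
    exact MeasurableSet.iInter fun j => (measurableSet_eq_fun (measurable_pi_apply j) measurable_const).compl
  have hS : (⋃ k, orthantExp k '' Set.univ : Set (Fin n → ℝ)) =ᵐ[volume] Set.univ :=
    Filter.eventuallyEq_univ.2 hae
  rw [← setLIntegral_univ, ← setLIntegral_congr hS,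
    lintegral_iUnion (fun k => by
      rw [image_orthantExp]
      exact hG.inter (measurableSet_orthantIndex k)) ?_, tsum_fintype]
  · refine Finset.sum_congr rfl fun k _ => ?_
    rw [lintegral_image_eq_lintegral_abs_det_fderiv_mul volume MeasurableSet.univ
      (fun t _ => (hasFDerivAt_orthantExp k t).hasFDerivWithinAt)
      ((Function.LeftInverse.injective (orthantLog_orthantExp k)).injOn), setLIntegral_univ]
    simp only [abs_det_orthantExp]
  · intro k l hkl
    rw [Function.onFun, image_orthantExp, image_orthantExp]
    refine Set.disjoint_left.2 fun x hx hx' => hkl ?_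
    exact hx.2.symm.trans hx'.2

/-- Exponential coordinates on the orthants of `ℝⁿ`, rotated by a linear isometry. -/
noncomputable def rotatedExp (R : EuclideanSpace ℝ (Fin n) ≃ₗᵢ[ℝ] EuclideanSpace ℝ (Fin n))
    (k : Fin (2 ^ n)) (t : EuclideanSpace ℝ (Fin n)) : EuclideanSpace ℝ (Fin n) :=
  R (WithLp.toLp 2 (orthantExp k t.ofLp))

theorem chart_rotatedExp (R : EuclideanSpace ℝ (Fin n) ≃ₗᵢ[ℝ] EuclideanSpace ℝ (Fin n)) :
    Chart (volume : Measure (EuclideanSpace ℝ (Fin n))) volume (rotatedExp R)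
      (fun t => orthantWeight t.ofLp) where
  measurable_map k := R.continuous.measurable.comp ((WithLp.measurable_toLp 2 _).comp
    ((measurable_orthantExp k).comp (WithLp.measurable_ofLp 2 _)))
  measurable_weight := by
    unfold orthantWeight
    fun_prop
  weight_pos t := orthantWeight_pos _
  lintegral_eq h hh := by
    have h1 := R.measurePreserving.lintegral_comp hh
    have h2 := (EuclideanSpace.volume_preserving_symm_measurableEquiv_toLp (Fin n)).symm.lintegral_comp
      (hh.comp R.continuous.measurable)
    rw [← h1]
    refine h2.symm.trans ?_
    rw [lintegral_eq_sum_orthantExp]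
    refine Finset.sum_congr rfl fun k _ => ?_
    exact ((EuclideanSpace.volume_preserving_symm_measurableEquiv_toLp (Fin n)).lintegral_comp_emb
      (MeasurableEquiv.measurableEmbedding _) _).symm
  exists_inverse := by
    refine ⟨fun x => WithLp.toLp 2 (orthantLog (R.symm x).ofLp),
      fun x => orthantIndex (R.symm x).ofLp, ?_, ?_, ?_, ?_⟩
    · exact (WithLp.measurable_toLp 2 _).comp (measurable_orthantLog.comp
        ((WithLp.measurable_ofLp 2 _).comp R.symm.continuous.measurable))
    · intro k
      exact ((WithLp.measurable_ofLp 2 _).comp R.symm.continuous.measurable)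
        (measurableSet_orthantIndex k)
    · intro k t
      simp [rotatedExp, orthantLog_orthantExp]
    · intro k t
      simp [rotatedExp, orthantIndex_orthantExp]

end OrthantChart

/-! ### The Fourier transform turns translations into characters. -/

section Fourier

open scoped FourierTransform

variable {n : ℕ} {F : Type*} [NormedAddCommGroup F] [InnerProductSpace ℂ F]

/-- The character `ξ ↦ exp(-2πi ⟨b, ξ⟩)`. -/
noncomputable def character (b : EuclideanSpace ℝ (Fin n)) : EuclideanSpace ℝ (Fin n) →ᵇ ℂ :=
  BoundedContinuousFunction.ofNormedAddCommGroup
    (fun ξ => (Real.fourierChar (-inner ℝ b ξ) : ℂ)) (by fun_prop) 1 (fun ξ => (Circle.norm_coe _).le)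

theorem character_apply (b ξ : EuclideanSpace ℝ (Fin n)) :
    character b ξ = (Real.fourierChar (-inner ℝ b ξ) : ℂ) := rfl

/-- Translation by `b` on `L²(ℝⁿ; F)`. -/
noncomputable def translation (b : EuclideanSpace ℝ (Fin n)) : L2 n F →ₗᵢ[ℂ] L2 n F :=
  Lp.compMeasurePreservingₗᵢ ℂ (fun t => t - b) (measurePreserving_sub_right volume b)

theorem coeFn_translation (b : EuclideanSpace ℝ (Fin n)) (g : L2 n F) :
    translation b g =ᵐ[volume] fun t => g (t - b) :=
  Lp.coeFn_compMeasurePreserving g (measurePreserving_sub_right volume b)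

theorem fourier_comp_sub (f : EuclideanSpace ℝ (Fin n) → F) (b ξ : EuclideanSpace ℝ (Fin n)) :
    𝓕 (fun t => f (t - b)) ξ = character b ξ • 𝓕 f ξ := by
  rw [Real.fourier_eq, Real.fourier_eq, ← integral_sub_right_eq_self _ (-b), ← integral_smul]
  refine integral_congr_ae (.of_forall fun v => ?_)
  simp only [sub_neg_eq_add, add_sub_cancel_right, inner_add_left, neg_add, AddChar.map_add_eq_mul,
    character_apply, Circle.smul_def, smul_smul, Circle.coe_mul]
  rw [mul_comm]

variable [CompleteSpace F]

/-- Both sides are continuous in g, so Schwartz functions suffice, where the transform is the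
classical integral. -/
theorem fourier_translation (b : EuclideanSpace ℝ (Fin n)) (g : L2 n F) :
    Lp.fourierTransformₗᵢ _ F (translation b g) =
      mulOp F (character b) (Lp.fourierTransformₗᵢ _ F g) := by
  refine DenseRange.induction_on (SchwartzMap.denseRange_toLpCLM (E := EuclideanSpace ℝ (Fin n))
    (F := F) (μ := volume) (p := 2) (by simp)) g (isClosed_eq ?_ ?_) fun f => ?_
  · exact (LinearIsometryEquiv.continuous _).comp (LinearIsometry.continuous _)
  · exact (ContinuousLinearMap.continuous _).comp (LinearIsometryEquiv.continuous _)
  · have h1 : translation b (SchwartzMap.toLpCLM ℝ F 2 volume f) =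
        (f.compSubConstCLM ℝ b).toLp 2 volume := by
      refine Lp.ext ?_
      have h0 : ∀ᵐ t, (f.toLp 2 volume : L2 n F) t = f t := f.coeFn_toLp 2 volume
      have h2 := (measurePreserving_sub_right volume b).quasiMeasurePreserving.ae h0
      filter_upwards [coeFn_translation b (SchwartzMap.toLpCLM ℝ F 2 volume f),
        (f.compSubConstCLM ℝ b).coeFn_toLp 2 volume, h2] with t h3 h4 h5
      rw [h3, h4, SchwartzMap.compSubConstCLM_apply]
      exact h5
    have h2 : Lp.fourierTransformₗᵢ _ F (translation b (SchwartzMap.toLpCLM ℝ F 2 volume f)) =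
        (𝓕 (f.compSubConstCLM ℝ b)).toLp 2 volume := by
      rw [h1]
      exact SchwartzMap.toLp_fourier_eq (f.compSubConstCLM ℝ b)
    have h3 : Lp.fourierTransformₗᵢ _ F (SchwartzMap.toLpCLM ℝ F 2 volume f) =
        (𝓕 f).toLp 2 volume := SchwartzMap.toLp_fourier_eq f
    rw [h2, h3]
    refine Lp.ext ?_
    filter_upwards [(𝓕 (f.compSubConstCLM ℝ b)).coeFn_toLp 2 volume, (𝓕 f).coeFn_toLp 2 volume,
      coeFn_mulOp (character b) ((𝓕 f).toLp 2 volume)] with ξ h4 h5 h6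
    rw [h4, h6, h5, SchwartzMap.fourier_coe, SchwartzMap.fourier_coe, ← fourier_comp_sub]
    rfl

end Fourier

/-! ### Simultaneous diagonalization of the dilations. -/

section MellinUnitary

variable {n : ℕ}

/-- The unitary map diagonalizing all dilations that are diagonal in the frame `R`. -/
noncomputable def mellinUnitary
    (R : EuclideanSpace ℝ (Fin n) ≃ₗᵢ[ℝ] EuclideanSpace ℝ (Fin n)) :
    L2 n ℂ ≃ₗᵢ[ℂ] L2 n (EuclideanSpace ℂ (Fin (2 ^ n))) :=
  (chartUnitary (chart_rotatedExp R)).trans (Lp.fourierTransformₗᵢ _ _)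

/-- The logarithmic translation vector of the dilation `diag(a)`. -/
noncomputable def logShift (a : Fin n → ℝ) : EuclideanSpace ℝ (Fin n) :=
  WithLp.toLp 2 fun j => Real.log (a j) / (2 * Real.pi)

/-- The sign and the 2π in the exponential coordinates are chosen so that this shift has the Fourier
character exp(-i Σ s_j log a_j), with no rescaling of s. -/
theorem orthantExp_sub_logShift {a : Fin n → ℝ} (ha : ∀ j, 0 < a j) (k : Fin (2 ^ n))
    (t : EuclideanSpace ℝ (Fin n)) :
    orthantExp k (t - logShift a).ofLp = fun j => a j * orthantExp k t.ofLp j := by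
  ext j
  have h : -(2 * Real.pi) * (t - logShift a).ofLp j =
      -(2 * Real.pi) * t.ofLp j + Real.log (a j) := by
    simp only [logShift, WithLp.ofLp_sub, Pi.sub_apply]
    field_simp
    ring
  rw [orthantExp, orthantExp, h, Real.exp_add, Real.exp_log (ha j)]
  ring

/-- The weight is the square root of the Jacobian; this is the source of the -1/2 in the exponent of
`absPow`. -/
theorem orthantWeight_sub_logShift (a : Fin n → ℝ) (t : EuclideanSpace ℝ (Fin n)) :
    orthantWeight t.ofLp =
      (∏ j, Real.exp (-(1 / 2) * Real.log (a j))) * orthantWeight (t - logShift a).ofLp := by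
  rw [orthantWeight, orthantWeight, ← Finset.prod_mul_distrib]
  refine Finset.prod_congr rfl fun j _ => ?_
  rw [mul_left_comm, ← Real.exp_add]
  congr 2
  simp only [logShift, WithLp.ofLp_sub, Pi.sub_apply]
  field_simp
  ring

theorem absPow_eq {a : Fin n → ℝ} (ha : ∀ j, 0 < a j) (s : EuclideanSpace ℝ (Fin n)) :
    absPow a s = ((∏ j, Real.exp (-(1 / 2) * Real.log (a j)) : ℝ) : ℂ) *
      character (logShift a) s := by
  rw [character_apply, Real.fourierChar_apply, PiLp.inner_apply, ← Real.exp_sum,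
    Complex.ofReal_exp, ← Complex.exp_add, absPow, ← Complex.exp_sum]
  congr 1
  push_cast
  rw [mul_neg, ← neg_mul, Finset.mul_sum, Finset.sum_mul, ← Finset.sum_add_distrib]
  refine Finset.sum_congr rfl fun j _ => ?_
  have hpi : (Real.pi : ℂ) ≠ 0 := by exact_mod_cast Real.pi_ne_zero
  simp only [logShift, RCLike.inner_apply, conj_trivial, abs_of_pos (ha j)]
  push_cast
  field_simp
  ring

theorem mellinUnitary_dilation
    (R : EuclideanSpace ℝ (Fin n) ≃ₗᵢ[ℝ] EuclideanSpace ℝ (Fin n)) {a : Fin n → ℝ}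
    (ha : ∀ j, 0 < a j) {D : EuclideanSpace ℝ (Fin n) → EuclideanSpace ℝ (Fin n)}
    (hD : ∀ y : Fin n → ℝ, D (R (WithLp.toLp 2 y)) = R (WithLp.toLp 2 fun j => a j * y j))
    {f g : L2 n ℂ} (hg : ∀ᵐ x, g x = f (D x)) :
    ∀ᵐ s, mellinUnitary R g s = absPow a s • mellinUnitary R f s := by
  set hc := chart_rotatedExp R
  set c : ℂ := ((∏ j, Real.exp (-(1 / 2) * Real.log (a j)) : ℝ) : ℂ) with hcdef
  have hchart : chartUnitary hc g = c • translation (logShift a) (chartUnitary hc f) := by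
    refine Lp.ext ?_
    have h1 := (measurePreserving_sub_right volume (logShift a)).quasiMeasurePreserving.ae
      (coeFn_chartUnitary hc f)
    filter_upwards [coeFn_chartUnitary hc g, pullback_congr_ae hc hg, h1,
      coeFn_translation (logShift a) (chartUnitary hc f),
      Lp.coeFn_smul c (translation (logShift a) (chartUnitary hc f))] with t h2 h3 h4 h5 h6
    rw [h2, h3, h6, Pi.smul_apply, h5, h4]
    ext i
    have h7 : D (rotatedExp R i t) = rotatedExp R i (t - logShift a) := by
      rw [rotatedExp, hD, rotatedExp, orthantExp_sub_logShift ha]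
    simp only [pullback, PiLp.smul_apply]
    rw [h7, orthantWeight_sub_logShift a t, smul_eq_mul, ← mul_assoc, Complex.ofReal_mul]
  have h : mellinUnitary R g = c • mulOp _ (character (logShift a)) (mellinUnitary R f) := by
    simp only [mellinUnitary, LinearIsometryEquiv.trans_apply]
    rw [hchart, map_smul, fourier_translation]
  rw [h]
  filter_upwards [Lp.coeFn_smul c (mulOp _ (character (logShift a)) (mellinUnitary R f)),
    coeFn_mulOp (character (logShift a)) (mellinUnitary R f)] with s h1 h2
  rw [h1, Pi.smul_apply, h2, smul_smul, absPow_eq ha]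

end MellinUnitary

/-! ### Dilations of L² by invertible matrices. -/

section Dilation

variable {n : ℕ}

theorem measurable_mulVec (A : Matrix (Fin n) (Fin n) ℝ) :
    Measurable fun x : EuclideanSpace ℝ (Fin n) => WithLp.toLp 2 (A *ᵥ x.ofLp) :=
  (LinearMap.continuous_of_finiteDimensional (Matrix.toEuclideanLin A)).measurable

theorem map_mulVec_volume {A : Matrix (Fin n) (Fin n) ℝ} (hA : A.det ≠ 0) :
    Measure.map (fun x : EuclideanSpace ℝ (Fin n) => WithLp.toLp 2 (A *ᵥ x.ofLp)) volume =
      ENNReal.ofReal |A.det⁻¹| • volume := by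
  have hdet : LinearMap.det (Matrix.toEuclideanLin A) = A.det := LinearMap.det_toLpLin 2 A
  have h := Measure.map_linearMap_addHaar_eq_smul_addHaar
    (volume : Measure (EuclideanSpace ℝ (Fin n))) (f := Matrix.toEuclideanLin A) (by rwa [hdet])
  rw [hdet] at h
  exact h

theorem eLpNorm_comp_mulVec {A : Matrix (Fin n) (Fin n) ℝ} (hA : A.det ≠ 0)
    {f : EuclideanSpace ℝ (Fin n) → ℂ} (hf : StronglyMeasurable f) :
    eLpNorm (fun x : EuclideanSpace ℝ (Fin n) => f (WithLp.toLp 2 (A *ᵥ x.ofLp))) 2 volume =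
      ENNReal.ofReal (|A.det| ^ (-(1 / 2) : ℝ)) * eLpNorm f 2 volume := by
  have h := eLpNorm_map_measure (p := 2) (g := f) (μ := volume)
    (f := fun x : EuclideanSpace ℝ (Fin n) => WithLp.toLp 2 (A *ᵥ x.ofLp))
    hf.aestronglyMeasurable (measurable_mulVec A).aemeasurable
  rw [map_mulVec_volume hA, eLpNorm_smul_measure_of_ne_top (by simp), smul_eq_mul] at h
  refine h.symm.trans ?_
  rw [ENNReal.ofReal_rpow_of_nonneg (abs_nonneg _) (by simp), abs_inv,
    Real.inv_rpow (abs_nonneg _), ← Real.rpow_neg (abs_nonneg _)]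
  simp

theorem memLp_comp_mulVec {A : Matrix (Fin n) (Fin n) ℝ} (hA : A.det ≠ 0) (f : L2 n ℂ) :
    MemLp (fun x : EuclideanSpace ℝ (Fin n) => f (WithLp.toLp 2 (A *ᵥ x.ofLp))) 2 volume := by
  refine ⟨((Lp.stronglyMeasurable f).comp_measurable (measurable_mulVec A)).aestronglyMeasurable, ?_⟩
  rw [eLpNorm_comp_mulVec hA (Lp.stronglyMeasurable f)]
  exact ENNReal.mul_lt_top ENNReal.ofReal_lt_top (Lp.eLpNorm_lt_top f)

/-- The dilation `f ↦ f ∘ A` of `L²(ℝⁿ)`, for an invertible matrix `A`. -/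
noncomputable def dilation {A : Matrix (Fin n) (Fin n) ℝ} (hA : A.det ≠ 0) (f : L2 n ℂ) : L2 n ℂ :=
  (memLp_comp_mulVec hA f).toLp _

theorem coeFn_dilation {A : Matrix (Fin n) (Fin n) ℝ} (hA : A.det ≠ 0) (f : L2 n ℂ) :
    ∀ᵐ x, dilation hA f x = f (WithLp.toLp 2 (A *ᵥ x.ofLp)) :=
  (memLp_comp_mulVec hA f).coeFn_toLp

theorem norm_dilation {A : Matrix (Fin n) (Fin n) ℝ} (hA : A.det ≠ 0) (f : L2 n ℂ) :
    ‖dilation hA f‖ = |A.det| ^ (-(1 / 2) : ℝ) * ‖f‖ := by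
  rw [dilation, Lp.norm_toLp, eLpNorm_comp_mulVec hA (Lp.stronglyMeasurable f),
    ENNReal.toReal_mul, ENNReal.toReal_ofReal (by positivity), Lp.norm_def]

theorem setIntegral_norm_le (f : L2 n ℂ) {S : Set (EuclideanSpace ℝ (Fin n))}
    (hS : volume S ≠ ∞) : ∫ x in S, ‖f x‖ ≤ ‖f‖ * (volume S ^ (1 / 2 : ℝ)).toReal := by
  have hm : AEStronglyMeasurable f (volume.restrict S) :=
    (Lp.stronglyMeasurable f).aestronglyMeasurable
  rw [integral_norm_eq_lintegral_enorm hm, ← eLpNorm_one_eq_lintegral_enorm, Lp.norm_def,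
    ← ENNReal.toReal_mul]
  refine ENNReal.toReal_mono (ENNReal.mul_ne_top (Lp.eLpNorm_ne_top f)
    (ENNReal.rpow_ne_top_of_nonneg (by norm_num) hS)) ?_
  refine (eLpNorm_le_eLpNorm_mul_rpow_measure_univ (q := 2) (by norm_num) hm).trans ?_
  refine mul_le_mul' (eLpNorm_mono_measure _ Measure.restrict_le_self) (le_of_eq ?_)
  rw [Measure.restrict_apply_univ]
  norm_num

end Dilation

/-! ### From the weak form to the pointwise integral formula. -/

section WeakForm

variable {Ω : Type*} [MeasurableSpace Ω] {μ : Measure Ω} {n : ℕ} {K : Ω → ℂ}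
  {A : Ω → Matrix (Fin n) (Fin n) ℝ}

theorem aemeasurable_mulVec_prod (hA : ∀ i j, AEMeasurable (fun u => A u i j) μ)
    (ν : Measure (EuclideanSpace ℝ (Fin n))) [SFinite ν] :
    AEMeasurable (fun p : Ω × EuclideanSpace ℝ (Fin n) => WithLp.toLp 2 (A p.1 *ᵥ p.2.ofLp))
      (μ.prod ν) := by
  refine (WithLp.measurable_toLp 2 _).comp_aemeasurable (aemeasurable_pi_lambda _ fun i => ?_)
  simp only [Matrix.mulVec, dotProduct]
  refine Finset.aemeasurable_fun_sum _ fun j _ => ((hA i j).comp_fst).mul ?_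
  have : Measurable fun p : Ω × EuclideanSpace ℝ (Fin n) => p.2.ofLp j := by fun_prop
  exact this.aemeasurable

variable [SFinite μ]

omit [SFinite μ] in
-- By Cauchy–Schwarz the integral of |f ∘ A(u)| over S is at most |det A(u)|^(-1/2) ‖f‖ |S|^(1/2),
-- so `hKA` supplies the dominating function.
theorem integrable_kernel_prod_restrict (hK : AEStronglyMeasurable K μ)
    (hA : ∀ i j, AEMeasurable (fun u => A u i j) μ) (hdet : ∀ u, (A u).det ≠ 0)
    (hKA : Integrable (fun u => ((|(A u).det| ^ (-(1 / 2) : ℝ) : ℝ) : ℂ) * K u) μ)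
    (f : L2 n ℂ) {S : Set (EuclideanSpace ℝ (Fin n))} (hS : volume S < ∞) :
    Integrable (fun p : Ω × EuclideanSpace ℝ (Fin n) =>
      K p.1 * f (WithLp.toLp 2 (A p.1 *ᵥ p.2.ofLp))) (μ.prod (volume.restrict S)) := by
  have : IsFiniteMeasure ((volume : Measure (EuclideanSpace ℝ (Fin n))).restrict S) :=
    ⟨by rwa [Measure.restrict_apply_univ]⟩
  have hm : AEStronglyMeasurable (fun p : Ω × EuclideanSpace ℝ (Fin n) =>
      K p.1 * f (WithLp.toLp 2 (A p.1 *ᵥ p.2.ofLp))) (μ.prod (volume.restrict S)) :=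
    hK.comp_fst.mul ((Lp.stronglyMeasurable f).measurable.comp_aemeasurable
      (aemeasurable_mulVec_prod hA _)).aestronglyMeasurable
  rw [integrable_prod_iff hm]
  constructor
  · refine .of_forall fun u => ?_
    exact Integrable.const_mul (((memLp_comp_mulVec (hdet u) f).restrict S).integrable (by norm_num)) (K u)
  · refine ((hKA.norm.mul_const (‖f‖ * (volume S ^ (1 / 2 : ℝ)).toReal))).mono'
      hm.norm.integral_prod_right' (.of_forall fun u => ?_)
    have h1 : ∫ x in S, ‖f (WithLp.toLp 2 (A u *ᵥ x.ofLp))‖ =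
        ∫ x in S, ‖dilation (hdet u) f x‖ := by
      refine integral_congr_ae (ae_restrict_of_ae ?_)
      filter_upwards [coeFn_dilation (hdet u) f] with x hx
      rw [hx]
    have h2 := setIntegral_norm_le (dilation (hdet u) f) hS.ne
    rw [norm_dilation] at h2
    simp only [norm_mul, Complex.norm_real]
    rw [integral_const_mul, h1, Real.norm_of_nonneg (mul_nonneg (norm_nonneg _)
      (integral_nonneg fun _ => norm_nonneg _)), Real.norm_of_nonneg (by positivity)]
    calc ‖K u‖ * ∫ x in S, ‖dilation (hdet u) f x‖
        ≤ ‖K u‖ * (|(A u).det| ^ (-(1 / 2) : ℝ) * ‖f‖ * (volume S ^ (1 / 2 : ℝ)).toReal) := by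
          gcongr
      _ = _ := by ring

/-- Testing against indicators of sets of finite measure and swapping integrals identifies the
integrals of both sides over every such set. -/
theorem isHausdorff_of_weak (hK : AEStronglyMeasurable K μ)
    (hA : ∀ i j, AEMeasurable (fun u => A u i j) μ) (hdet : ∀ u, (A u).det ≠ 0)
    (hKA : Integrable (fun u => ((|(A u).det| ^ (-(1 / 2) : ℝ) : ℝ) : ℂ) * K u) μ)
    {H : L2 n ℂ →L[ℂ] L2 n ℂ}
    (hH : ∀ f h, inner ℂ h (H f) = ∫ u, K u * inner ℂ h (dilation (hdet u) f) ∂μ) :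
    IsHausdorff μ K A H := by
  intro f
  have hint := fun (S : Set (EuclideanSpace ℝ (Fin n))) (hS : volume S < ∞) =>
    integrable_kernel_prod_restrict hK hA hdet hKA f hS
  have hae : ∀ᵐ x : EuclideanSpace ℝ (Fin n),
      Integrable (fun u => K u * f (WithLp.toLp 2 (A u *ᵥ x.ofLp))) μ :=
    ae_of_forall_measure_lt_top_ae_restrict _ fun S _ hS => (hint S hS).prod_left_ae
  have heq : H f =ᵐ[volume] fun x => ∫ u, K u * f (WithLp.toLp 2 (A u *ᵥ x.ofLp)) ∂μ := by
    refine ae_eq_of_forall_setIntegral_eq_of_sigmaFinite ?_ ?_ ?_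
    · intro S _ hS
      exact integrableOn_Lp_of_measure_ne_top (H f) (by norm_num) hS.ne
    · intro S _ hS
      exact (hint S hS).integral_prod_right
    · intro S hSm hS
      rw [← integral_integral_swap (hint S hS), ← L2.inner_indicatorConstLp_one hSm hS.ne, hH]
      refine integral_congr_ae (.of_forall fun u => ?_)
      simp only
      rw [integral_const_mul, L2.inner_indicatorConstLp_one]
      congr 1
      refine integral_congr_ae (ae_restrict_of_ae ?_)
      filter_upwards [coeFn_dilation (hdet u) f] with x hx
      rw [hx]
  filter_upwards [hae, heq] with x h1 h2
  exact ⟨h1, h2⟩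

end WeakForm

/-! ### The scalar symbol φ. -/

section Symbol

variable {Ω : Type*} [MeasurableSpace Ω] {μ : Measure Ω} {n : ℕ} {K : Ω → ℂ}
  {a : Ω → Fin n → ℝ}

theorem norm_absPow {v : Fin n → ℝ} (hv : ∀ j, 0 < v j) (s : EuclideanSpace ℝ (Fin n)) :
    ‖absPow v s‖ = |∏ j, v j| ^ (-(1 / 2) : ℝ) := by
  have hpos : 0 < ∏ j, v j := Finset.prod_pos fun j _ => hv j
  rw [absPow_eq hv, norm_mul, character_apply, Circle.norm_coe, mul_one, Complex.norm_real,
    Real.norm_of_nonneg (Finset.prod_nonneg fun j _ => (Real.exp_pos _).le), abs_of_pos hpos,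
    ← Real.finsetProd_rpow _ _ fun j _ => (hv j).le]
  refine Finset.prod_congr rfl fun j _ => ?_
  rw [Real.rpow_def_of_pos (hv j), mul_comm]

theorem measurable_absPow :
    Measurable fun p : (Fin n → ℝ) × EuclideanSpace ℝ (Fin n) => absPow p.1 p.2 := by
  unfold absPow
  refine Finset.measurable_fun_prod _ fun j _ => ?_
  have h1 : Measurable fun p : (Fin n → ℝ) × EuclideanSpace ℝ (Fin n) => |p.1 j| :=
    ((measurable_pi_apply j).comp measurable_fst).abs
  have h2 : Measurable fun p : (Fin n → ℝ) × EuclideanSpace ℝ (Fin n) => p.2 j := by fun_prop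
  have h3 := Complex.measurable_ofReal.comp (Real.measurable_log.comp h1)
  have h4 := Complex.measurable_ofReal.comp h2
  exact Complex.measurable_exp.comp ((measurable_const.sub (measurable_const.mul h4)).mul h3)

theorem continuous_absPow (v : Fin n → ℝ) : Continuous (absPow v) := by
  unfold absPow
  fun_prop

theorem aestronglyMeasurable_mul_absPow (hK : AEStronglyMeasurable K μ)
    (ha : AEMeasurable a μ) (s : EuclideanSpace ℝ (Fin n)) :
    AEStronglyMeasurable (fun u => K u * absPow (a u) s) μ :=
  hK.mul (measurable_absPow.comp_aemeasurable (ha.prodMk aemeasurable_const)).aestronglyMeasurable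

omit [MeasurableSpace Ω] in
theorem norm_mul_absPow (hpos : ∀ u j, 0 < a u j) (u : Ω) (s : EuclideanSpace ℝ (Fin n)) :
    ‖K u * absPow (a u) s‖ = ‖((|∏ j, a u j| ^ (-(1 / 2) : ℝ) : ℝ) : ℂ) * K u‖ := by
  rw [norm_mul, norm_absPow (hpos u), norm_mul, Complex.norm_real,
    Real.norm_of_nonneg (by positivity), mul_comm]

theorem integrable_mul_absPow (hK : AEStronglyMeasurable K μ) (ha : AEMeasurable a μ)
    (hpos : ∀ u j, 0 < a u j)
    (hKa : Integrable (fun u => ((|∏ j, a u j| ^ (-(1 / 2) : ℝ) : ℝ) : ℂ) * K u) μ)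
    (s : EuclideanSpace ℝ (Fin n)) : Integrable (fun u => K u * absPow (a u) s) μ :=
  hKa.mono (aestronglyMeasurable_mul_absPow hK ha s)
    (.of_forall fun u => (norm_mul_absPow hpos u s).le)

theorem exists_symbol (hK : AEStronglyMeasurable K μ) (ha : AEMeasurable a μ)
    (hpos : ∀ u j, 0 < a u j)
    (hKa : Integrable (fun u => ((|∏ j, a u j| ^ (-(1 / 2) : ℝ) : ℝ) : ℂ) * K u) μ) :
    ∃ φ : EuclideanSpace ℝ (Fin n) →ᵇ ℂ, ∀ s, φ s = scalarSymbol μ K a s := by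
  refine ⟨BoundedContinuousFunction.ofNormedAddCommGroup (scalarSymbol μ K a)
    (continuous_of_dominated (aestronglyMeasurable_mul_absPow hK ha)
      (fun s => .of_forall fun u => (norm_mul_absPow hpos u s).le) hKa.norm
      (.of_forall fun u => continuous_const.mul (continuous_absPow (a u))))
    (∫ u, ‖((|∏ j, a u j| ^ (-(1 / 2) : ℝ) : ℝ) : ℂ) * K u‖ ∂μ) fun s => ?_, fun s => rfl⟩
  refine norm_integral_le_of_norm_le hKa.norm (.of_forall fun u => ?_)
  exact (norm_mul_absPow hpos u s).le

/-- The modulus of `absPow (a u) s` does not depend on s, so the double integrand is dominated by a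
product of an integrable function of u and one of s, and Fubini applies. -/
theorem integral_inner_eq_inner_mulOp [SFinite μ] {F : Type*} [NormedAddCommGroup F]
    [InnerProductSpace ℂ F] (hK : AEStronglyMeasurable K μ)
    (ha : AEMeasurable a μ) (hpos : ∀ u j, 0 < a u j)
    (hKa : Integrable (fun u => ((|∏ j, a u j| ^ (-(1 / 2) : ℝ) : ℝ) : ℂ) * K u) μ)
    {φ : EuclideanSpace ℝ (Fin n) →ᵇ ℂ} (hφ : ∀ s, φ s = scalarSymbol μ K a s)
    (f h : L2 n F) {g : Ω → L2 n F} (hg : ∀ u, ∀ᵐ s, g u s = absPow (a u) s • f s) :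
    ∫ u, K u * inner ℂ h (g u) ∂μ = inner ℂ h (mulOp F φ f) := by
  have hq := L2.integrable_inner (𝕜 := ℂ) h f
  have hint : Integrable (fun p : Ω × EuclideanSpace ℝ (Fin n) =>
      K p.1 * absPow (a p.1) p.2 * inner ℂ (h p.2) (f p.2)) (μ.prod volume) := by
    refine (hKa.mul_prod hq).mono ?_ (.of_forall fun p => ?_)
    · exact (hK.comp_fst.mul (measurable_absPow.comp_aemeasurable
        (ha.comp_fst.prodMk measurable_snd.aemeasurable)).aestronglyMeasurable).mul hq.1.comp_snd
    · rw [norm_mul, norm_mul (_ * K p.1), norm_mul_absPow hpos]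
  calc ∫ u, K u * inner ℂ h (g u) ∂μ
      = ∫ u, (∫ s, K u * absPow (a u) s * inner ℂ (h s) (f s)) ∂μ := by
        refine integral_congr_ae (.of_forall fun u => ?_)
        simp only
        rw [L2.inner_def, ← integral_const_mul]
        refine integral_congr_ae ?_
        filter_upwards [hg u] with s hs
        rw [hs, inner_smul_right, mul_assoc]
    _ = ∫ s, ∫ u, K u * absPow (a u) s * inner ℂ (h s) (f s) ∂μ := integral_integral_swap hint
    _ = inner ℂ h (mulOp F φ f) := by
        rw [L2.inner_def]
        refine integral_congr_ae ?_
        filter_upwards [coeFn_mulOp φ f] with s hs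
        rw [hs, inner_smul_right, hφ, integral_mul_const, scalarSymbol]

end Symbol

/-! ### Simultaneous orthogonal diagonalization. -/

section Diagonalization

variable {Ω : Type*} {n : ℕ} {A : Ω → Matrix (Fin n) (Fin n) ℝ}

theorem exists_isDiagonalization (hA : ∀ u, (A u).IsHermitian)
    (hcomm : ∀ u v, Commute (A u) (A v)) : ∃ C a, IsDiagonalization A C a := by
  classical
  let T : Ω → Module.End ℝ (EuclideanSpace ℝ (Fin n)) := fun u => Matrix.toEuclideanLin (A u)
  have hT : ∀ u, (T u).IsSymmetric := fun u => Matrix.isSymmetric_toEuclideanLin_iff.2 (hA u)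
  have hTc : Pairwise (Function.onFun Commute T) := fun u v _ => by
    ext x i
    have h := congrArg (fun M => (M *ᵥ x.ofLp) i) (hcomm u v).eq
    simpa [T, ← Matrix.mulVec_mulVec] using h
  let V : (Ω → ℝ) → Submodule ℝ (EuclideanSpace ℝ (Fin n)) :=
    fun γ => ⨅ u, Module.End.eigenspace (T u) (γ u)
  have hV : OrthogonalFamily ℝ (fun γ => V γ) fun γ => (V γ).subtypeₗᵢ :=
    LinearMap.IsSymmetric.orthogonalFamily_iInf_eigenspaces hT
  have hint : DirectSum.IsInternal V :=
    LinearMap.IsSymmetric.directSum_isInternal_of_pairwise_commute hT hTc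
  -- The joint eigenvalues γ : Ω → ℝ may form an infinite index set, but independent subspaces of a
  -- finite-dimensional space are almost all zero; this allows an adapted orthonormal basis.
  have hfin : {γ | V γ ≠ ⊥}.Finite := WellFoundedGT.finite_ne_bot_of_iSupIndep hV.independent
  have := hfin.fintype
  have hint' : DirectSum.IsInternal fun γ : {γ | V γ ≠ ⊥} => V γ :=
    DirectSum.isInternal_ne_bot_iff.2 hint
  have hV' : OrthogonalFamily ℝ (fun γ : {γ | V γ ≠ ⊥} => V γ) fun γ => (V γ).subtypeₗᵢ :=
    hV.comp Subtype.val_injective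
  have hn : Module.finrank ℝ (EuclideanSpace ℝ (Fin n)) = n := by simp
  let b := hint'.subordinateOrthonormalBasis hn hV'
  let γ : Fin n → Ω → ℝ := fun j => (hint'.subordinateOrthonormalBasisIndex hn j hV').1
  have hb : ∀ u j, T u (b j) = γ j u • b j := fun u j => by
    have h := hint'.subordinateOrthonormalBasis_subordinate hn j hV'
    exact Module.End.mem_eigenspace_iff.1 ((Submodule.mem_iInf _).1 h u)
  let C : Matrix (Fin n) (Fin n) ℝ :=
    (EuclideanSpace.basisFun (Fin n) ℝ).toBasis.toMatrix b
  have hC : C ∈ Matrix.orthogonalGroup (Fin n) ℝ :=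
    OrthonormalBasis.toMatrix_orthonormalBasis_mem_unitary _ b
  have hCij : ∀ i j, C i j = b j i := fun i j => by
    simp [C, Module.Basis.toMatrix_apply]
  have hCC : C⁻¹ * C = 1 := by
    rw [Matrix.nonsing_inv_mul]
    exact Matrix.isUnit_det_of_left_inverse ((Matrix.mem_orthogonalGroup_iff' _ _).1 hC)
  refine ⟨C, fun u j => γ j u, hC, fun u => ?_⟩
  have hAC : A u * C = C * Matrix.diagonal fun j => γ j u := by
    ext i j
    rw [Matrix.mul_diagonal, Matrix.mul_apply]
    have h := congrArg (fun x : EuclideanSpace ℝ (Fin n) => x i) (hb u j)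
    simp only [PiLp.smul_apply, smul_eq_mul] at h
    rw [hCij, mul_comm, ← h]
    simp [T, Matrix.mulVec, dotProduct, hCij]
  rw [mul_assoc, hAC, ← mul_assoc, hCC, one_mul]

variable {C : Matrix (Fin n) (Fin n) ℝ} {a : Ω → Fin n → ℝ}

theorem IsDiagonalization.transpose_mul (h : IsDiagonalization A C a) : Cᵀ * C = 1 :=
  (Matrix.mem_orthogonalGroup_iff' _ _).1 h.orthogonal

theorem IsDiagonalization.inv_eq (h : IsDiagonalization A C a) : C⁻¹ = Cᵀ :=
  Matrix.inv_eq_left_inv h.transpose_mul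

theorem IsDiagonalization.mul_eq (h : IsDiagonalization A C a) (u : Ω) :
    A u * C = C * Matrix.diagonal (a u) := by
  rw [← h.diagonal u, h.inv_eq, ← mul_assoc, ← mul_assoc, mul_eq_one_comm.1 h.transpose_mul,
    one_mul]

theorem IsDiagonalization.pos (h : IsDiagonalization A C a) (hA : ∀ u, (A u).PosDef) (u : Ω)
    (j : Fin n) : 0 < a u j := by
  have hinj : Function.Injective C.mulVec := fun x y hxy => by
    have := congrArg (Cᵀ *ᵥ ·) hxy
    simpa [Matrix.mulVec_mulVec, h.transpose_mul] using this
  have h1 := (hA u).conjTranspose_mul_mul_same hinj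
  rw [Matrix.conjTranspose_eq_transpose_of_trivial, ← h.inv_eq, h.diagonal u,
    Matrix.posDef_diagonal_iff] at h1
  exact h1 j

theorem IsDiagonalization.det_eq (h : IsDiagonalization A C a) (u : Ω) :
    (A u).det = ∏ j, a u j := by
  rw [← Matrix.det_diagonal, ← h.diagonal u, Matrix.det_mul, Matrix.det_mul, mul_right_comm,
    ← Matrix.det_mul, h.inv_eq, h.transpose_mul, Matrix.det_one, one_mul]

/-- As C is fixed, the eigenvalues are linear in the entries of A(u), so no measurable selection is
needed. -/
theorem IsDiagonalization.aemeasurable [MeasurableSpace Ω] {μ : Measure Ω}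
    (h : IsDiagonalization A C a) (hA : ∀ i j, AEMeasurable (fun u => A u i j) μ) :
    AEMeasurable a μ := by
  refine aemeasurable_pi_lambda _ fun j => ?_
  have h1 : (fun u => a u j) = fun u => ∑ k, (∑ l, C⁻¹ j l * A u l k) * C k j := by
    ext u
    have := congrFun (congrFun (h.diagonal u) j) j
    rw [Matrix.diagonal_apply_eq] at this
    rw [← this]
    simp [Matrix.mul_apply]
  rw [h1]
  exact Finset.aemeasurable_fun_sum _ fun k _ => (Finset.aemeasurable_fun_sum _ fun l _ =>
    (hA l k).const_mul _).mul_const _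

theorem IsDiagonalization.exists_linearIsometryEquiv (h : IsDiagonalization A C a) :
    ∃ R : EuclideanSpace ℝ (Fin n) ≃ₗᵢ[ℝ] EuclideanSpace ℝ (Fin n),
      ∀ u (y : Fin n → ℝ), WithLp.toLp 2 (A u *ᵥ (R (WithLp.toLp 2 y)).ofLp) =
        R (WithLp.toLp 2 fun j => a u j * y j) := by
  have hmem : Matrix.toEuclideanCLM (𝕜 := ℝ) C ∈
      unitary (EuclideanSpace ℝ (Fin n) →L[ℝ] EuclideanSpace ℝ (Fin n)) :=
    Unitary.map_mem (Matrix.toEuclideanCLM (n := Fin n) (𝕜 := ℝ)) h.orthogonal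
  refine ⟨Unitary.linearIsometryEquiv ⟨_, hmem⟩, fun u y => ?_⟩
  have hR : ∀ z : Fin n → ℝ, Unitary.linearIsometryEquiv ⟨_, hmem⟩ (WithLp.toLp 2 z) =
      WithLp.toLp 2 (C *ᵥ z) := fun z => rfl
  rw [hR, hR]
  simp only [Matrix.mulVec_mulVec, h.mul_eq]
  rw [← Matrix.mulVec_mulVec]
  congr 2
  ext j
  rw [Matrix.mulVec_diagonal]

end Diagonalization

/-! ### Assembly of the unitary equivalence. -/

section Main

variable {Ω : Type*} [MeasurableSpace Ω] {μ : Measure Ω} [SFinite μ] {n : ℕ} {K : Ω → ℂ}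
  {A : Ω → Matrix (Fin n) (Fin n) ℝ} {C : Matrix (Fin n) (Fin n) ℝ} {a : Ω → Fin n → ℝ}

/-- Stated without H, so that it can both define H and afterwards apply to any other
diagonalization. -/
theorem IsDiagonalization.exists_unitary (h : IsDiagonalization A C a)
    (hK : AEStronglyMeasurable K μ)
    (hA : ∀ i j, AEMeasurable (fun u => A u i j) μ) (hpos : ∀ u, (A u).PosDef)
    (hKA : Integrable (fun u => ((|(A u).det| ^ (-(1 / 2) : ℝ) : ℝ) : ℂ) * K u) μ) :
    (∀ s, Integrable (fun u => K u * absPow (a u) s) μ) ∧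
    ∃ φ : EuclideanSpace ℝ (Fin n) →ᵇ ℂ, (∀ s, φ s = scalarSymbol μ K a s) ∧
      ∃ U : L2 n ℂ ≃ₗᵢ[ℂ] L2 n (EuclideanSpace ℂ (Fin (2 ^ n))), ∀ f g : L2 n ℂ,
        ∫ u, K u * inner ℂ g (dilation (hpos u).det_pos.ne' f) ∂μ =
          inner ℂ (U g) (mulOp _ φ (U f)) := by
  have ha := h.aemeasurable hA
  have hapos := h.pos hpos
  simp only [h.det_eq] at hKA
  refine ⟨integrable_mul_absPow hK ha hapos hKA, ?_⟩
  obtain ⟨φ, hφ⟩ := exists_symbol hK ha hapos hKA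
  obtain ⟨R, hR⟩ := h.exists_linearIsometryEquiv
  refine ⟨φ, hφ, mellinUnitary R, fun f g => ?_⟩
  rw [← integral_inner_eq_inner_mulOp hK ha hapos hKA hφ (mellinUnitary R f) (mellinUnitary R g)
    (g := fun u => mellinUnitary R (dilation (hpos u).det_pos.ne' f)) fun u =>
      mellinUnitary_dilation R (hapos u) (D := fun x => WithLp.toLp 2 (A u *ᵥ x.ofLp)) (hR u)
        (coeFn_dilation _ f)]
  simp only [LinearIsometryEquiv.inner_map_map]

end Main

theorem sigmaFinite_of_sigmaCompact {Ω : Type*} [TopologicalSpace Ω] [SigmaCompactSpace Ω]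
    [MeasurableSpace Ω] (μ : Measure Ω) [IsFiniteMeasureOnCompacts μ] : SigmaFinite μ :=
  ⟨⟨{ set := compactCovering Ω
      set_mem := fun _ => trivial
      finite := fun k => (isCompact_compactCovering Ω k).measure_lt_top
      spanning := iUnion_compactCovering Ω }⟩⟩

end HausdorffOperator

open HausdorffOperator in
theorem corollary7 {Ω : Type*} [TopologicalSpace Ω] [SigmaCompactSpace Ω] [MeasurableSpace Ω]
    [BorelSpace Ω] (μ : Measure Ω) [μ.Regular] (n : ℕ)
    (K : Ω → ℂ) (hK : LocallyIntegrable K μ)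
    (A : Ω → Matrix (Fin n) (Fin n) ℝ)
    (hAmeas : ∀ i j, AEMeasurable (fun u => A u i j) μ)
    (hApos : ∀ u, (A u).PosDef)
    (hAcomm : ∀ u v, Commute (A u) (A v))
    (hKA : Integrable (fun u => ((|(A u).det| ^ (-(1 / 2) : ℝ) : ℝ) : ℂ) * K u) μ) :
    (∃ C a, HausdorffOperator.IsDiagonalization A C a) ∧
    ∃ H : HausdorffOperator.L2 n ℂ →L[ℂ] HausdorffOperator.L2 n ℂ,
      HausdorffOperator.IsHausdorff μ K A H ∧
      ∀ C a, HausdorffOperator.IsDiagonalization A C a →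
        (∀ s, Integrable (fun u => K u * HausdorffOperator.absPow (a u) s) μ) ∧
        ∃ φ : EuclideanSpace ℝ (Fin n) →ᵇ ℂ,
          (∀ s, φ s = HausdorffOperator.scalarSymbol μ K a s) ∧
          (∃ U : HausdorffOperator.L2 n ℂ ≃ₗᵢ[ℂ]
              HausdorffOperator.L2 n (EuclideanSpace ℂ (Fin (2 ^ n))),
            ∀ f, U (H f) =
              HausdorffOperator.mulOp (EuclideanSpace ℂ (Fin (2 ^ n))) φ (U f)) ∧
          spectrum ℂ H = spectrum ℂ (HausdorffOperator.mulOp ℂ φ) ∧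
          spectrum ℂ H = closure (Set.range φ) ∧
          HausdorffOperator.pointSpectrum H =
            HausdorffOperator.pointSpectrum (HausdorffOperator.mulOp ℂ φ) ∧
          HausdorffOperator.continuousSpectrum H =
            HausdorffOperator.continuousSpectrum (HausdorffOperator.mulOp ℂ φ) ∧
          HausdorffOperator.residualSpectrum H = ∅ ∧
          IsLUB (Set.range fun s => ‖φ s‖) ‖H‖ := by
  have := sigmaFinite_of_sigmaCompact μ
  have hdiag := exists_isDiagonalization (fun u => (hApos u).isHermitian) hAcomm
  refine ⟨hdiag, ?_⟩
  have hdet : ∀ u, (A u).det ≠ 0 := fun u => (hApos u).det_pos.ne'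
  -- Measurability of K comes from dividing the integrable function in `hKA` by its nonvanishing
  -- determinant factor.
  have hKm : AEStronglyMeasurable K μ := by
    have hd : AEMeasurable (fun u => (A u).det) μ := by
      simp only [Matrix.det_apply]
      refine Finset.aemeasurable_fun_sum _ fun σ _ => AEMeasurable.const_smul ?_ _
      exact Finset.aemeasurable_fun_prod _ fun i _ => hAmeas _ _
    have hc := (Complex.measurable_ofReal.comp_aemeasurable
      ((measurable_abs.comp_aemeasurable hd).pow_const (-(1 / 2) : ℝ))).inv
    refine (hc.mul hKA.1.aemeasurable).aestronglyMeasurable.congr (.of_forall fun u => ?_)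
    have h0 : ((|(A u).det| ^ (-(1 / 2) : ℝ) : ℝ) : ℂ) ≠ 0 :=
      Complex.ofReal_ne_zero.2 (Real.rpow_pos_of_pos (abs_pos.2 (hdet u)) _).ne'
    exact inv_mul_cancel_left₀ h0 (K u)
  obtain ⟨C₀, a₀, h₀⟩ := hdiag
  obtain ⟨-, φ₀, -, U₀, hU₀⟩ := h₀.exists_unitary hKm hAmeas hApos hKA
  let H : L2 n ℂ →L[ℂ] L2 n ℂ := U₀.symm.toContinuousLinearEquiv.toContinuousLinearMap ∘L
    mulOp _ φ₀ ∘L U₀.toContinuousLinearEquiv.toContinuousLinearMap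
  have hH : ∀ f g, inner ℂ g (H f) = ∫ u, K u * inner ℂ g (dilation (hdet u) f) ∂μ := by
    intro f g
    rw [hU₀, ← U₀.inner_map_map]
    simp [H]
  refine ⟨H, isHausdorff_of_weak hKm hAmeas hdet hKA hH, fun C a h => ?_⟩
  obtain ⟨hint, φ, hφ, U, hU⟩ := h.exists_unitary hKm hAmeas hApos hKA
  -- Both sides have the same inner products with all U g, by the weak form of H.
  have hUH : ∀ f, U (H f) = mulOp _ φ (U f) := fun f => by
    refine ext_inner_left ℂ fun g => ?_
    obtain ⟨g, rfl⟩ := U.surjective g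
    rw [← hU, U.inner_map_map, hH]
  have hspec := spectrum_eq_of_intertwine hUH
  have hpoint := pointSpectrum_eq_of_intertwine hUH
  have hres := residualSpectrum_eq_of_intertwine hUH
  rw [spectrum_mulOp] at hspec
  rw [residualSpectrum_mulOp] at hres
  have hpoint' : pointSpectrum H = pointSpectrum (mulOp ℂ φ) := by
    rw [hpoint]
    ext z
    rw [mem_pointSpectrum_mulOp_iff, mem_pointSpectrum_mulOp_iff]
  refine ⟨hint, φ, hφ, ⟨U, hUH⟩, hspec.trans (spectrum_mulOp φ).symm, hspec, hpoint', ?_, hres, ?_⟩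
  · rw [continuousSpectrum_eq_of_residualSpectrum_eq_empty hres,
      continuousSpectrum_eq_of_residualSpectrum_eq_empty (residualSpectrum_mulOp φ),
      hpoint', hspec, spectrum_mulOp]
  · rw [norm_eq_of_intertwine hUH]
    exact isLUB_norm_mulOp φ
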